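/- Let $A_s>0$, $\beta>0$, $h_I\in\mathbb R\setminus\{0\}$, $\sigma_x\in\mathbb R$ and $A\ge 0$, and let $$d(r)=\frac{r}{\bigl[1+(|r|/A_s)^{2\beta}\bigr]^{1/(2\beta)}}\qquad(r\in\mathbb R)$$ be the SSPA amplifier characteristic. Consider the real channel $Y=h_I\,d(X)+N$, where $N$ is Gaussian with mean $0$ and variance $1$ and is independent of the input $X$. For a probability distribution $F_X$ of $X$ on $\mathbb R$, let $I(X;Y)$ be the resulting mutual information in bits, that is, the Kullback--Leibler divergence, with logarithm to base $2$, of the joint law of $(X,Y)$ from the product of its marginals. Among all probability distributions $F_X$ on $\mathbb R$ with $\mathbb E[X^2]\le\sigma_x^2$ and $|X|\le A$ almost surely, there is exactly one that maximises $I(X;Y)$, and this distribution is discrete with finitely many mass points. -/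

import Mathlib

open MeasureTheory ProbabilityTheory

namespace AWGN

noncomputable section

/-- The SSPA amplifier characteristic with output saturation voltage `As` and smoothness `β`:
`d(r) = r / (1 + (|r| / As) ^ (2β)) ^ (1 / (2β))`. For a positive integer `β` the absolute value
has no effect; for other `β > 0` it makes the amplitude characteristic, given by the same formula
for `r ≥ 0`, an odd function on the real line. -/
def sspa (As β : ℝ) (r : ℝ) : ℝ :=
  r / (1 + (|r| / As) ^ (2 * β)) ^ (1 / (2 * β))

theorem measurable_sspa (As β : ℝ) : Measurable (sspa As β) := by
  unfold sspa
  fun_prop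

/-- The joint law of `(X, Y)`, where `Y = hI * d(X) + N`, the input `X` has law `μ`, and `N` is
standard Gaussian noise (unit variance) independent of `X`. -/
def jointLaw (As β hI : ℝ) (μ : Measure ℝ) : Measure (ℝ × ℝ) :=
  (μ.prod (gaussianReal 0 1)).map (fun p : ℝ × ℝ => (p.1, hI * sspa As β p.1 + p.2))

/-- The mutual information, in bits, of two real random variables with joint law `J`: the
Kullback-Leibler divergence of the joint law from the product of its marginals. -/
def mutualInfo (J : Measure (ℝ × ℝ)) : ENNReal :=
  InformationTheory.klDiv J (J.fst.prod J.snd) / ENNReal.ofReal (Real.log 2)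

/-- Input laws satisfying the peak constraint `|X| ≤ A` (almost surely) and the average-power
constraint `E[X ^ 2] ≤ σ ^ 2`. The peak constraint makes `X ^ 2` integrable. -/
structure Feasible (σ A : ℝ) (μ : Measure ℝ) : Prop where
  isProbabilityMeasure : IsProbabilityMeasure μ
  peak : ∀ᵐ x ∂μ, |x| ≤ A
  averagePower : ∫ x, x ^ 2 ∂μ ≤ σ ^ 2

/-- A feasible input law attaining the maximum of `I(X; Y)` over all feasible input laws. -/
def IsOptimal (As β hI σ A : ℝ) (μ : Measure ℝ) : Prop :=
  Feasible σ A μ ∧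
    ∀ ν : Measure ℝ, Feasible σ A ν →
      mutualInfo (jointLaw As β hI ν) ≤ mutualInfo (jointLaw As β hI μ)

end

end AWGN

/-! Put `u = hI * d`, a bounded, continuous, injective map. Since `Y = u(X) + N`, the mutual
information is the output entropy minus the noise entropy, and the latter does not depend on the
input. So one maximises `crossEntropy u μ μ`.

Existence: the peak constraint makes the feasible set weakly compact, and the output entropy is
weakly continuous because all output densities share Gaussian bounds (`isCompact_feasible`,
`continuous_crossEntropy_self`).

Uniqueness: moving from an optimal `μ` towards a feasible `ν` gives `crossEntropy u μ ν ≤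
crossEntropy u μ μ` (`crossEntropy_le_of_isMax`). If `ν` is optimal too, the divergence between the
two output laws vanishes. Deconvolving the noise and inverting `u` then gives `ν = μ`.

Finite support: with `F` the mean surprisal of `s + N` and `C` the optimal entropy, a Lagrange
multiplier `l ≥ 0` gives `F(u x) ≤ C + l (x² - σ²)` on `[-A, A]`, with equality `μ`-a.e. Here `F` is
real analytic and grows quadratically. Infinitely many equality points would accumulate. If `l = 0`,
this forces `F` to be constant. If `l > 0`, accumulation away from `0` spreads the equality to a
half-line, where the left side is bounded and the right side is not. At `0`, where `d` need not be
analytic, either `2β` is an integer and the positive branch of `d` continues analytically, or a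
non-integer power `x^(2+2β)` would have to match an integer power (`not_frequently_eq_sq_nhdsGT`).
-/

namespace AWGN

/-! ### Gaussian densities with bounded mean. -/

/-- Normalising constant of the standard Gaussian density. -/
noncomputable def gaussNorm : ℝ := (√(2 * Real.pi))⁻¹

theorem gaussNorm_pos : 0 < gaussNorm := by unfold gaussNorm; positivity

theorem gaussNorm_le_one : gaussNorm ≤ 1 := by
  unfold gaussNorm
  apply inv_le_one_of_one_le₀
  rw [Real.one_le_sqrt]
  nlinarith [Real.pi_gt_three]

theorem gaussianPDFReal_one (s y : ℝ) :
    gaussianPDFReal s 1 y = gaussNorm * Real.exp (-(y - s) ^ 2 / 2) := by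
  simp [gaussianPDFReal, gaussNorm]

theorem continuous_uncurry_gaussianPDFReal :
    Continuous fun p : ℝ × ℝ => gaussianPDFReal p.1 1 p.2 := by
  simp only [gaussianPDFReal_one]
  fun_prop

/-- Half of the exponent is given up to be uniform in `s`: the inequality behind it is `(y - 2s)² ≥
0`. This is the Gaussian envelope for dominated convergence. -/
theorem gaussianPDFReal_le {s B : ℝ} (hs : |s| ≤ B) (y : ℝ) :
    gaussianPDFReal s 1 y ≤ gaussNorm * Real.exp (-(y ^ 2 / 4 - B ^ 2 / 2)) := by
  rw [gaussianPDFReal_one]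
  have := gaussNorm_pos
  gcongr
  have : s ^ 2 ≤ B ^ 2 := sq_le_sq' (neg_le_of_abs_le hs) (le_of_abs_le hs)
  nlinarith [sq_nonneg (y - 2 * s)]

theorem le_gaussianPDFReal {s B : ℝ} (hs : |s| ≤ B) (y : ℝ) :
    gaussNorm * Real.exp (-(y ^ 2 + B ^ 2)) ≤ gaussianPDFReal s 1 y := by
  rw [gaussianPDFReal_one]
  have := gaussNorm_pos
  gcongr
  have : s ^ 2 ≤ B ^ 2 := sq_le_sq' (neg_le_of_abs_le hs) (le_of_abs_le hs)
  nlinarith [sq_nonneg (y + s)]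

theorem gaussianPDFReal_le_gaussNorm (s y : ℝ) : gaussianPDFReal s 1 y ≤ gaussNorm := by
  rw [gaussianPDFReal_one]
  apply mul_le_of_le_one_right gaussNorm_pos.le
  rw [Real.exp_le_one_iff]
  nlinarith [sq_nonneg (y - s)]

/-! ### Output density, surprisal and cross entropy. -/

/-- The density at `y` of `u(X) + N`, where `X` has law `μ` and `N` is standard Gaussian. -/
noncomputable def outDensity (u : ℝ → ℝ) (μ : Measure ℝ) (y : ℝ) : ℝ :=
  ∫ x, gaussianPDFReal (u x) 1 y ∂μ

/-- The law of `u(X) + N`. -/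
noncomputable def outLaw (u : ℝ → ℝ) (μ : Measure ℝ) : Measure ℝ :=
  volume.withDensity fun y => ENNReal.ofReal (outDensity u μ y)

/-- The surprisal `-log p(y)` of the output density. -/
noncomputable def surprisal (u : ℝ → ℝ) (μ : Measure ℝ) (y : ℝ) : ℝ :=
  -Real.log (outDensity u μ y)

/-- The expected surprisal of the output `s + N`. -/
noncomputable def meanSurprisal (u : ℝ → ℝ) (μ : Measure ℝ) (s : ℝ) : ℝ :=
  ∫ y, surprisal u μ y ∂gaussianReal s 1

/-- The cross entropy of the output under `ν` relative to the output under `μ`. -/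
noncomputable def crossEntropy (u : ℝ → ℝ) (μ ν : Measure ℝ) : ℝ :=
  ∫ x, meanSurprisal u μ (u x) ∂ν

section Bounds

variable {u : ℝ → ℝ} (hu : Measurable u) {B : ℝ} (hB : ∀ x, |u x| ≤ B)
  {μ : Measure ℝ} [IsProbabilityMeasure μ]

include hu in
theorem integrable_gaussianPDFReal_input (μ : Measure ℝ) [IsFiniteMeasure μ] (y : ℝ) :
    Integrable (fun x => gaussianPDFReal (u x) 1 y) μ := by
  refine Integrable.of_bound (C := gaussNorm) ?_ (ae_of_all _ fun x => ?_)
  · exact (continuous_uncurry_gaussianPDFReal.measurable.comp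
      (hu.prodMk measurable_const)).aestronglyMeasurable
  · rw [Real.norm_of_nonneg (gaussianPDFReal_nonneg _ _ _)]
    exact gaussianPDFReal_le_gaussNorm _ _

include hu in
theorem measurable_outDensity : Measurable (outDensity u μ) := by
  unfold outDensity
  have : StronglyMeasurable (fun p : ℝ × ℝ => gaussianPDFReal (u p.2) 1 p.1) :=
    (continuous_uncurry_gaussianPDFReal.measurable.comp
      ((hu.comp measurable_snd).prodMk measurable_fst)).stronglyMeasurable
  exact this.integral_prod_right'.measurable

include hu in
theorem outDensity_le_gaussNorm (y : ℝ) : outDensity u μ y ≤ gaussNorm := by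
  have := integral_mono (integrable_gaussianPDFReal_input hu μ y) (integrable_const gaussNorm)
    fun x => gaussianPDFReal_le_gaussNorm (u x) y
  simpa [outDensity] using this

include hu hB in
theorem outDensity_le (y : ℝ) :
    outDensity u μ y ≤ gaussNorm * Real.exp (-(y ^ 2 / 4 - B ^ 2 / 2)) := by
  have := integral_mono (integrable_gaussianPDFReal_input hu μ y) (integrable_const _)
    fun x => gaussianPDFReal_le (hB x) y
  simpa [outDensity] using this

include hu hB in
theorem le_outDensity (y : ℝ) :
    gaussNorm * Real.exp (-(y ^ 2 + B ^ 2)) ≤ outDensity u μ y := by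
  have := integral_mono (integrable_const _) (integrable_gaussianPDFReal_input hu μ y)
    fun x => le_gaussianPDFReal (hB x) y
  simpa [outDensity] using this

include hu hB in
theorem outDensity_pos (y : ℝ) : 0 < outDensity u μ y :=
  (mul_pos gaussNorm_pos (Real.exp_pos _)).trans_le (le_outDensity hu hB y)

include hu in
theorem measurable_surprisal : Measurable (surprisal u μ) :=
  (Real.measurable_log.comp (measurable_outDensity hu)).neg

include hu hB in
-- Unit variance keeps the output density below `1`. The sign allows the surprisal to serve as the
-- density of a measure, whose moment generating function is used below.
theorem surprisal_nonneg (y : ℝ) : 0 ≤ surprisal u μ y := by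
  rw [surprisal, neg_nonneg]
  exact Real.log_nonpos (outDensity_pos hu hB y).le
    ((outDensity_le_gaussNorm hu y).trans gaussNorm_le_one)

include hu hB in
theorem surprisal_le (y : ℝ) : surprisal u μ y ≤ y ^ 2 + B ^ 2 - Real.log gaussNorm := by
  have h := Real.log_le_log (mul_pos gaussNorm_pos (Real.exp_pos _)) (le_outDensity hu hB (μ := μ) y)
  rw [Real.log_mul gaussNorm_pos.ne' (Real.exp_pos _).ne', Real.log_exp] at h
  rw [surprisal]
  linarith

include hu hB in
theorem le_surprisal (y : ℝ) : y ^ 2 / 4 - B ^ 2 / 2 ≤ surprisal u μ y := by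
  have h := Real.log_le_log (outDensity_pos hu hB y) (outDensity_le hu hB (μ := μ) y)
  rw [Real.log_mul gaussNorm_pos.ne' (Real.exp_pos _).ne', Real.log_exp] at h
  rw [surprisal]
  linarith [Real.log_nonpos gaussNorm_pos.le gaussNorm_le_one]

theorem integrable_sq_gaussianReal (s : ℝ) : Integrable (fun y => y ^ 2) (gaussianReal s 1) :=
  (memLp_id_gaussianReal (μ := s) (v := 1) 2).integrable_sq

theorem integral_sq_gaussianReal (s : ℝ) : ∫ y, y ^ 2 ∂gaussianReal s 1 = s ^ 2 + 1 := by
  have h := variance_eq_sub (memLp_id_gaussianReal (μ := s) (v := 1) 2)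
  rw [variance_id_gaussianReal] at h
  simp only [Pi.pow_apply, id_eq, integral_id_gaussianReal, NNReal.coe_one] at h
  linarith

include hu hB in
theorem abs_surprisal_le (y : ℝ) : |surprisal u μ y| ≤ y ^ 2 + (B ^ 2 - Real.log gaussNorm) := by
  rw [abs_of_nonneg (surprisal_nonneg hu hB y)]
  linarith [surprisal_le hu hB (μ := μ) y]

include hu hB in
theorem integrable_surprisal (s : ℝ) : Integrable (surprisal u μ) (gaussianReal s 1) :=
  ((integrable_sq_gaussianReal s).add (integrable_const (B ^ 2 - Real.log gaussNorm))).mono'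
    (measurable_surprisal hu).aestronglyMeasurable (ae_of_all _ (abs_surprisal_le hu hB))

include hu hB in
theorem meanSurprisal_nonneg (s : ℝ) : 0 ≤ meanSurprisal u μ s :=
  integral_nonneg (surprisal_nonneg hu hB)

include hu hB in
theorem meanSurprisal_le (s : ℝ) :
    meanSurprisal u μ s ≤ s ^ 2 + 1 + (B ^ 2 - Real.log gaussNorm) := by
  have := integral_mono (integrable_surprisal hu hB (μ := μ) s)
    ((integrable_sq_gaussianReal s).add (integrable_const (B ^ 2 - Real.log gaussNorm)))
    fun y => (le_abs_self _).trans (abs_surprisal_le hu hB y)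
  simp only [Pi.add_apply] at this
  rw [integral_add (integrable_sq_gaussianReal s) (integrable_const _),
    integral_sq_gaussianReal] at this
  simpa [meanSurprisal] using this

include hu hB in
-- This quadratic growth is what rules out a constant mean surprisal when the multiplier is zero.
theorem le_meanSurprisal (s : ℝ) : (s ^ 2 + 1) / 4 - B ^ 2 / 2 ≤ meanSurprisal u μ s := by
  have := integral_mono (((integrable_sq_gaussianReal s).div_const 4).sub
    (integrable_const (B ^ 2 / 2))) (integrable_surprisal hu hB (μ := μ) s)
    fun y => le_surprisal hu hB y
  rw [Pi.sub_def, integral_sub ((integrable_sq_gaussianReal s).div_const 4) (integrable_const _),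
    integral_div, integral_sq_gaussianReal] at this
  simpa [meanSurprisal] using this

theorem integral_gaussianReal_one (f : ℝ → ℝ) (s : ℝ) :
    ∫ y, f y ∂gaussianReal s 1 = ∫ y, gaussianPDFReal s 1 y * f y := by
  rw [integral_gaussianReal_eq_integral_smul one_ne_zero]; rfl

include hu in
theorem measurable_meanSurprisal : Measurable (meanSurprisal u μ) := by
  have h : StronglyMeasurable (fun p : ℝ × ℝ => gaussianPDFReal p.1 1 p.2 * surprisal u μ p.2) :=
    (continuous_uncurry_gaussianPDFReal.measurable.mul
      ((measurable_surprisal hu).comp measurable_snd)).stronglyMeasurable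
  have := (h.integral_prod_right' (ν := volume)).measurable
  convert this using 2 with s
  exact integral_gaussianReal_one _ s

include hu hB in
theorem abs_meanSurprisal_input_le (x : ℝ) :
    |meanSurprisal u μ (u x)| ≤ B ^ 2 + 1 + (B ^ 2 - Real.log gaussNorm) := by
  rw [abs_of_nonneg (meanSurprisal_nonneg hu hB _)]
  have := sq_le_sq' (neg_le_of_abs_le (hB x)) (le_of_abs_le (hB x))
  linarith [meanSurprisal_le hu hB (μ := μ) (u x)]

include hu hB in
theorem integrable_meanSurprisal (ν : Measure ℝ) [IsFiniteMeasure ν] :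
    Integrable (fun x => meanSurprisal u μ (u x)) ν :=
  Integrable.of_bound ((measurable_meanSurprisal hu).comp hu).aestronglyMeasurable _
    (ae_of_all _ (abs_meanSurprisal_input_le hu hB))

/-! ### Analyticity of the mean surprisal. -/

/-- The mean surprisal is a Gaussian factor times a moment generating function. -/
theorem meanSurprisal_eq_mgf (hu : Measurable u) (hB : ∀ x, |u x| ≤ B) (s : ℝ) :
    meanSurprisal u μ s = Real.exp (-s ^ 2 / 2) *
      mgf id ((gaussianReal 0 1).withDensity fun y => ENNReal.ofReal (surprisal u μ y)) s := by
  rw [mgf, integral_withDensity_eq_integral_toReal_smul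
    (measurable_surprisal hu).ennreal_ofReal (ae_of_all _ fun _ => ENNReal.ofReal_lt_top),
    integral_gaussianReal_one, meanSurprisal, integral_gaussianReal_one, ← integral_const_mul]
  congr 1
  ext y
  rw [ENNReal.toReal_ofReal (surprisal_nonneg hu hB y), gaussianPDFReal_one, gaussianPDFReal_one]
  have : Real.exp (-(y - s) ^ 2 / 2) =
      Real.exp (-s ^ 2 / 2) * Real.exp (s * y) * Real.exp (-(y - 0) ^ 2 / 2) := by
    rw [← Real.exp_add, ← Real.exp_add]; congr 1; ring
  rw [this, smul_eq_mul, id]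
  ring

include hu hB in
-- Tilting `N(0,1)` by `exp (s * y)` gives a multiple of `N(s,1)`, under which the surprisal is
-- integrable.
theorem integrable_exp_surprisal (s : ℝ) : Integrable (fun y => Real.exp (s * id y))
    ((gaussianReal 0 1).withDensity fun y => ENNReal.ofReal (surprisal u μ y)) := by
  rw [integrable_withDensity_iff_integrable_smul' (measurable_surprisal hu).ennreal_ofReal
    (ae_of_all _ fun _ => ENNReal.ofReal_lt_top)]
  have h := integrable_surprisal hu hB (μ := μ) s
  rw [gaussianReal_of_var_ne_zero _ one_ne_zero, integrable_withDensity_iff_integrable_smul'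
    (measurable_gaussianPDF _ _) (ae_of_all _ fun _ => gaussianPDF_lt_top)] at h ⊢
  refine (h.const_mul (Real.exp (s ^ 2 / 2))).congr (ae_of_all _ fun y => ?_)
  simp only [toReal_gaussianPDF, smul_eq_mul, id]
  rw [ENNReal.toReal_ofReal (surprisal_nonneg hu hB y), gaussianPDFReal_one, gaussianPDFReal_one]
  have : Real.exp (-(y - 0) ^ 2 / 2) * Real.exp (s * y) =
      Real.exp (s ^ 2 / 2) * Real.exp (-(y - s) ^ 2 / 2) := by
    rw [← Real.exp_add, ← Real.exp_add]; congr 1; ring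
  linear_combination -(gaussNorm * surprisal u μ y) * this

/-- A moment generating function is analytic in the interior of its domain of finiteness, which here
is the whole line. -/
theorem analyticOnNhd_meanSurprisal (hu : Measurable u) (hB : ∀ x, |u x| ≤ B) :
    AnalyticOnNhd ℝ (meanSurprisal u μ) Set.univ := by
  have h : meanSurprisal u μ = fun s => Real.exp (-s ^ 2 / 2) *
      mgf id ((gaussianReal 0 1).withDensity fun y => ENNReal.ofReal (surprisal u μ y)) s :=
    funext (meanSurprisal_eq_mgf hu hB)
  have hI : integrableExpSet id
      ((gaussianReal 0 1).withDensity fun y => ENNReal.ofReal (surprisal u μ y)) = Set.univ :=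
    Set.eq_univ_of_forall (integrable_exp_surprisal hu hB)
  rw [h]
  intro s _
  refine AnalyticAt.mul (by fun_prop) (analyticAt_mgf ?_)
  rw [hI, interior_univ]
  trivial

end Bounds

/-! ### Relative entropies of the channel laws. -/

theorem toReal_klDiv_withDensity {α : Type*} [MeasurableSpace α] {ρ : Measure α} [SigmaFinite ρ]
    {f g : α → ℝ} (hf : Measurable f) (hg : Measurable g) (hf0 : ∀ a, 0 < f a)
    (hg0 : ∀ a, 0 < g a)
    [IsProbabilityMeasure (ρ.withDensity fun a => ENNReal.ofReal (f a))]
    [IsProbabilityMeasure (ρ.withDensity fun a => ENNReal.ofReal (g a))]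
    (hint : Integrable (fun a => Real.log (f a) - Real.log (g a))
      (ρ.withDensity fun a => ENNReal.ofReal (f a))) :
    InformationTheory.klDiv (ρ.withDensity fun a => ENNReal.ofReal (f a))
        (ρ.withDensity fun a => ENNReal.ofReal (g a)) ≠ ⊤ ∧
      (InformationTheory.klDiv (ρ.withDensity fun a => ENNReal.ofReal (f a))
        (ρ.withDensity fun a => ENNReal.ofReal (g a))).toReal =
      ∫ a, (Real.log (f a) - Real.log (g a)) ∂(ρ.withDensity fun a => ENNReal.ofReal (f a)) := by
  set P := ρ.withDensity fun a => ENNReal.ofReal (f a) with hP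
  set Q := ρ.withDensity fun a => ENNReal.ofReal (g a) with hQ
  have hPQ : P = Q.withDensity fun a => ENNReal.ofReal (f a / g a) := by
    have hfg : Measurable fun a => ENNReal.ofReal (f a / g a) := (hf.div hg).ennreal_ofReal
    rw [hP, hQ, ← withDensity_mul _ hg.ennreal_ofReal hfg]
    congr 1
    ext a
    rw [Pi.mul_apply, ← ENNReal.ofReal_mul (hg0 a).le, mul_div_cancel₀ _ (hg0 a).ne']
  have hac : P ≪ Q := hPQ ▸ withDensity_absolutelyContinuous _ _
  have hr : P.rnDeriv Q =ᵐ[Q] fun a => ENNReal.ofReal (f a / g a) := by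
    conv_lhs => rw [hPQ]
    exact Measure.rnDeriv_withDensity _ (hf.div hg).ennreal_ofReal
  have hllr : llr P Q =ᵐ[P] fun a => Real.log (f a) - Real.log (g a) := by
    filter_upwards [hac.ae_le hr] with a ha
    rw [llr, ha, ENNReal.toReal_ofReal (div_pos (hf0 a) (hg0 a)).le,
      Real.log_div (hf0 a).ne' (hg0 a).ne']
  refine ⟨InformationTheory.klDiv_ne_top hac (hint.congr hllr.symm), ?_⟩
  -- Both measures have mass one, so the mass correction in `klDiv` vanishes.
  rw [InformationTheory.toReal_klDiv_of_measure_eq hac (by simp), integral_congr_ae hllr]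

/-- The Markov kernel `x ↦ N(u(x), 1)` of the channel. -/
noncomputable def gaussKernel (u : ℝ → ℝ) (hu : Measurable u) : Kernel ℝ ℝ where
  toFun x := gaussianReal (u x) 1
  measurable' := measurable_gaussianReal.comp (hu.prodMk measurable_const)

instance (u : ℝ → ℝ) (hu : Measurable u) : IsMarkovKernel (gaussKernel u hu) :=
  ⟨fun x => inferInstanceAs (IsProbabilityMeasure (gaussianReal (u x) 1))⟩

theorem gaussKernel_apply (u : ℝ → ℝ) (hu : Measurable u) (x : ℝ) :
    gaussKernel u hu x = gaussianReal (u x) 1 := rfl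

section Laws

variable {u : ℝ → ℝ} (hu : Measurable u) {B : ℝ} (hB : ∀ x, |u x| ≤ B)
  {μ ν : Measure ℝ} [IsProbabilityMeasure μ] [IsProbabilityMeasure ν]

theorem map_add_noise_eq_compProd (μ : Measure ℝ) [IsProbabilityMeasure μ] :
    (μ.prod (gaussianReal 0 1)).map (fun p : ℝ × ℝ => (p.1, u p.1 + p.2)) =
      μ ⊗ₘ gaussKernel u hu := by
  have hm : Measurable fun p : ℝ × ℝ => (p.1, u p.1 + p.2) := by fun_prop
  refine Measure.ext_of_lintegral _ fun f hf => ?_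
  have hfm : Measurable fun p : ℝ × ℝ => f (p.1, u p.1 + p.2) := hf.comp hm
  rw [lintegral_map hf hm, lintegral_prod _ hfm.aemeasurable,
    Measure.lintegral_compProd hf]
  congr 1
  ext x
  have : gaussKernel u hu x = (gaussianReal 0 1).map (u x + ·) := by
    rw [gaussianReal_map_const_add, zero_add, gaussKernel_apply]
  have hx : Measurable fun y => f (x, y) := hf.comp measurable_prodMk_left
  rw [this, lintegral_map hx (measurable_const_add _)]

theorem measurable_gaussianPDFReal_channel (hu : Measurable u) :
    Measurable fun p : ℝ × ℝ => gaussianPDFReal (u p.1) 1 p.2 := by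
  simp only [gaussianPDFReal_one]
  fun_prop

theorem compProd_eq_withDensity (μ : Measure ℝ) [IsProbabilityMeasure μ] :
    μ ⊗ₘ gaussKernel u hu =
      (μ.prod volume).withDensity fun p => ENNReal.ofReal (gaussianPDFReal (u p.1) 1 p.2) := by
  have hm := (measurable_gaussianPDFReal_channel hu).ennreal_ofReal
  refine Measure.ext_of_lintegral _ fun f hf => ?_
  rw [Measure.lintegral_compProd hf, lintegral_withDensity_eq_lintegral_mul _ hm hf,
    lintegral_prod _ (hm.mul hf).aemeasurable]
  congr 1
  ext x
  have hx : Measurable fun y => f (x, y) := hf.comp measurable_prodMk_left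
  rw [gaussKernel_apply, gaussianReal_of_var_ne_zero _ one_ne_zero,
    lintegral_withDensity_eq_lintegral_mul _ (measurable_gaussianPDF _ _) hx]
  rfl

theorem snd_compProd_eq_outLaw (μ : Measure ℝ) [IsProbabilityMeasure μ] :
    (μ ⊗ₘ gaussKernel u hu).snd = outLaw u μ := by
  have hm := (measurable_gaussianPDFReal_channel hu).ennreal_ofReal
  refine Measure.ext_of_lintegral _ fun f hf => ?_
  have hf2 : Measurable fun p : ℝ × ℝ => f p.2 := hf.comp measurable_snd
  rw [Measure.snd, lintegral_map hf measurable_snd, compProd_eq_withDensity,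
    lintegral_withDensity_eq_lintegral_mul _ hm hf2,
    lintegral_prod_symm _ (hm.mul hf2).aemeasurable, outLaw,
    lintegral_withDensity_eq_lintegral_mul _ (measurable_outDensity hu).ennreal_ofReal hf]
  congr 1
  ext y
  have hy : Measurable fun x => ENNReal.ofReal (gaussianPDFReal (u x) 1 y) := by
    simp only [gaussianPDFReal_one]
    fun_prop
  simp only [Pi.mul_apply]
  rw [lintegral_mul_const _ hy, outDensity,
    ofReal_integral_eq_lintegral_ofReal (integrable_gaussianPDFReal_input hu μ y)
      (ae_of_all _ fun _ => gaussianPDFReal_nonneg _ _ _)]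

include hu in
theorem isProbabilityMeasure_outLaw (μ : Measure ℝ) [IsProbabilityMeasure μ] :
    IsProbabilityMeasure (outLaw u μ) := by
  rw [← snd_compProd_eq_outLaw hu]; infer_instance

theorem prod_outLaw (hu : Measurable u) (μ : Measure ℝ) [IsProbabilityMeasure μ] :
    μ.prod (outLaw u μ) =
      (μ.prod volume).withDensity fun p => ENNReal.ofReal (outDensity u μ p.2) := by
  rw [outLaw, prod_withDensity_right (measurable_outDensity hu).ennreal_ofReal]

include hu hB in
theorem integrable_surprisal_snd :
    Integrable (fun p : ℝ × ℝ => surprisal u μ p.2) (ν ⊗ₘ gaussKernel u hu) := by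
  have hm : Measurable fun p : ℝ × ℝ => surprisal u μ p.2 :=
    (measurable_surprisal hu).comp measurable_snd
  rw [Measure.integrable_compProd_iff hm.aestronglyMeasurable]
  refine ⟨ae_of_all _ fun x => integrable_surprisal hu hB (u x), ?_⟩
  refine (integrable_meanSurprisal hu hB (μ := μ) ν).congr (ae_of_all _ fun x => ?_)
  refine integral_congr_ae (ae_of_all _ fun y => ?_)
  exact (Real.norm_of_nonneg (surprisal_nonneg hu hB y)).symm

include hB in
theorem crossEntropy_eq_integral_compProd :
    crossEntropy u μ ν = ∫ p, surprisal u μ p.2 ∂(ν ⊗ₘ gaussKernel u hu) := by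
  rw [Measure.integral_compProd (integrable_surprisal_snd hu hB)]
  rfl

include hu hB in
theorem integrable_surprisal_outLaw : Integrable (surprisal u μ) (outLaw u ν) := by
  rw [← snd_compProd_eq_outLaw hu]
  exact (integrable_map_measure (measurable_surprisal hu).aestronglyMeasurable
    measurable_snd.aemeasurable).2 (integrable_surprisal_snd hu hB)

include hu hB in
theorem crossEntropy_eq_integral_outLaw :
    crossEntropy u μ ν = ∫ y, surprisal u μ y ∂outLaw u ν := by
  rw [crossEntropy_eq_integral_compProd hu hB, ← snd_compProd_eq_outLaw hu, Measure.snd,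
    integral_map measurable_snd.aemeasurable (measurable_surprisal hu).aestronglyMeasurable]

include hu hB in
theorem crossEntropy_eq_integral :
    crossEntropy u μ ν = ∫ y, outDensity u ν y * surprisal u μ y := by
  rw [crossEntropy_eq_integral_outLaw hu hB, outLaw, integral_withDensity_eq_integral_toReal_smul
    (measurable_outDensity hu).ennreal_ofReal (ae_of_all _ fun _ => ENNReal.ofReal_lt_top)]
  congr 1
  ext y
  rw [ENNReal.toReal_ofReal (outDensity_pos hu hB y).le, smul_eq_mul]

include hu hB in
theorem toReal_klDiv_outLaw :
    InformationTheory.klDiv (outLaw u ν) (outLaw u μ) ≠ ⊤ ∧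
    (InformationTheory.klDiv (outLaw u ν) (outLaw u μ)).toReal =
      crossEntropy u μ ν - crossEntropy u ν ν := by
  have h1 := isProbabilityMeasure_outLaw hu ν
  have h2 := isProbabilityMeasure_outLaw hu μ
  have e : (fun y => Real.log (outDensity u ν y) - Real.log (outDensity u μ y)) =
      fun y => surprisal u μ y - surprisal u ν y := by
    ext y; simp only [surprisal]; ring
  have i1 := integrable_surprisal_outLaw hu hB (μ := μ) (ν := ν)
  have i2 := integrable_surprisal_outLaw hu hB (μ := ν) (ν := ν)
  unfold outLaw at h1 h2 i1 i2 ⊢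
  have := toReal_klDiv_withDensity (ρ := volume) (measurable_outDensity hu (μ := ν))
    (measurable_outDensity hu (μ := μ)) (outDensity_pos hu hB) (outDensity_pos hu hB)
    (by rw [e]; exact i1.sub i2)
  refine ⟨this.1, this.2.trans ?_⟩
  rw [e, integral_sub i1 i2, crossEntropy_eq_integral_outLaw hu hB,
    crossEntropy_eq_integral_outLaw hu hB]
  rfl

include hu hB in
/-- Gibbs' inequality for the output laws. -/
theorem crossEntropy_self_le : crossEntropy u ν ν ≤ crossEntropy u μ ν := by
  have := (toReal_klDiv_outLaw hu hB (μ := μ) (ν := ν)).2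
  linarith [ENNReal.toReal_nonneg (a := InformationTheory.klDiv (outLaw u ν) (outLaw u μ))]

include hu hB in
theorem outLaw_eq_of_crossEntropy_le (h : crossEntropy u μ ν ≤ crossEntropy u ν ν) :
    outLaw u ν = outLaw u μ := by
  have h1 := isProbabilityMeasure_outLaw hu ν
  have h2 := isProbabilityMeasure_outLaw hu μ
  obtain ⟨ht, hk⟩ := toReal_klDiv_outLaw hu hB (μ := μ) (ν := ν)
  rw [← InformationTheory.klDiv_eq_zero_iff]
  have h0 := ENNReal.toReal_nonneg (a := InformationTheory.klDiv (outLaw u ν) (outLaw u μ))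
  have : (InformationTheory.klDiv (outLaw u ν) (outLaw u μ)).toReal = 0 := by linarith
  exact ((ENNReal.toReal_eq_zero_iff _).1 this).resolve_right ht

/-- The differential entropy of the noise. -/
noncomputable def noiseEntropy : ℝ := ∫ y, -Real.log (gaussianPDFReal 0 1 y) ∂gaussianReal 0 1

theorem neg_log_gaussianPDFReal (s y : ℝ) :
    -Real.log (gaussianPDFReal s 1 y) = (y - s) ^ 2 / 2 - Real.log gaussNorm := by
  rw [gaussianPDFReal_one, Real.log_mul gaussNorm_pos.ne' (Real.exp_pos _).ne', Real.log_exp]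
  ring

theorem integrable_neg_log_gaussianPDFReal (s : ℝ) :
    Integrable (fun y => -Real.log (gaussianPDFReal s 1 y)) (gaussianReal s 1) := by
  simp_rw [neg_log_gaussianPDFReal]
  have h1 : MemLp (fun y => y - s) 2 (gaussianReal s 1) :=
    (memLp_id_gaussianReal (μ := s) (v := 1) 2).sub (memLp_const s)
  exact (h1.integrable_sq.div_const 2).sub (integrable_const _)

theorem integral_neg_log_gaussianPDFReal (s : ℝ) :
    ∫ y, -Real.log (gaussianPDFReal s 1 y) ∂gaussianReal s 1 = noiseEntropy := by
  have : gaussianReal s 1 = (gaussianReal 0 1).map (s + ·) := by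
    rw [gaussianReal_map_const_add, zero_add]
  rw [this, noiseEntropy, integral_map (measurable_const_add _).aemeasurable]
  · simp only [neg_log_gaussianPDFReal]; simp
  · exact (Real.measurable_log.comp (measurable_gaussianPDFReal _ _)).neg.aestronglyMeasurable

include hu in
theorem integrable_neg_log_channel :
    Integrable (fun p : ℝ × ℝ => -Real.log (gaussianPDFReal (u p.1) 1 p.2))
      (μ ⊗ₘ gaussKernel u hu) := by
  have hm : Measurable (fun p : ℝ × ℝ => -Real.log (gaussianPDFReal (u p.1) 1 p.2)) :=
    (Real.measurable_log.comp (measurable_gaussianPDFReal_channel hu)).neg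
  rw [Measure.integrable_compProd_iff hm.aestronglyMeasurable]
  refine ⟨ae_of_all _ fun x => integrable_neg_log_gaussianPDFReal (u x), ?_⟩
  refine (integrable_const noiseEntropy).congr (ae_of_all _ fun x => ?_)
  simp only
  rw [← integral_neg_log_gaussianPDFReal (u x)]
  refine integral_congr_ae (ae_of_all _ fun y => ?_)
  refine (Real.norm_of_nonneg ?_).symm
  rw [neg_nonneg]
  exact Real.log_nonpos (gaussianPDFReal_nonneg _ _ _)
    ((gaussianPDFReal_le_gaussNorm _ _).trans gaussNorm_le_one)

theorem integral_neg_log_channel :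
    ∫ p, -Real.log (gaussianPDFReal (u p.1) 1 p.2) ∂(μ ⊗ₘ gaussKernel u hu) = noiseEntropy := by
  rw [Measure.integral_compProd (integrable_neg_log_channel hu)]
  simp only [gaussKernel_apply, integral_neg_log_gaussianPDFReal]
  simp

include hB in
-- `I(X;Y) = h(Y) - h(Y|X)`, and given `X` the output is a translate of the noise, so `h(Y|X)` is
-- the noise entropy.
theorem toReal_klDiv_compProd :
    InformationTheory.klDiv (μ ⊗ₘ gaussKernel u hu) (μ.prod (outLaw u μ)) ≠ ⊤ ∧
    (InformationTheory.klDiv (μ ⊗ₘ gaussKernel u hu) (μ.prod (outLaw u μ))).toReal =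
      crossEntropy u μ μ - noiseEntropy := by
  have h1 : IsProbabilityMeasure (μ ⊗ₘ gaussKernel u hu) := inferInstance
  have := isProbabilityMeasure_outLaw hu μ
  have h2 : IsProbabilityMeasure (μ.prod (outLaw u μ)) := inferInstance
  have e : (fun p : ℝ × ℝ =>
      Real.log (gaussianPDFReal (u p.1) 1 p.2) - Real.log (outDensity u μ p.2)) =
      fun p => surprisal u μ p.2 - -Real.log (gaussianPDFReal (u p.1) 1 p.2) := by
    ext y; simp only [surprisal]; ring
  have i1 := integrable_surprisal_snd hu hB (μ := μ) (ν := μ)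
  have i2 := integrable_neg_log_channel hu (μ := μ)
  have i3 := integral_neg_log_channel hu (μ := μ)
  rw [crossEntropy_eq_integral_compProd hu hB, ← i3, ← integral_sub i1 i2]
  rw [compProd_eq_withDensity] at h1 i1 i2 ⊢
  rw [prod_outLaw hu] at h2 ⊢
  have := toReal_klDiv_withDensity (ρ := μ.prod volume) (measurable_gaussianPDFReal_channel hu)
    (g := fun p => outDensity u μ p.2) ((measurable_outDensity hu (μ := μ)).comp measurable_snd)
    (fun p => gaussianPDFReal_pos _ _ _ one_ne_zero)
    (fun p => outDensity_pos hu hB p.2) (by rw [e]; exact i1.sub i2)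
  rw [e] at this
  exact this

theorem outLaw_eq_conv (hu : Measurable u) (μ : Measure ℝ) [IsProbabilityMeasure μ] :
    outLaw u μ = (μ.map u) ∗ (gaussianReal 0 1) := by
  have hm : Measurable fun p : ℝ × ℝ => (p.1, u p.1 + p.2) := by fun_prop
  rw [← snd_compProd_eq_outLaw hu, ← map_add_noise_eq_compProd hu, Measure.snd,
    Measure.map_map measurable_snd hm, Measure.conv]
  have hp : (μ.map u).prod (gaussianReal 0 1) =
      (μ.prod (gaussianReal 0 1)).map (Prod.map u id) := by
    have := Measure.map_prod_map μ (gaussianReal 0 1) hu measurable_id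
    rwa [Measure.map_id] at this
  rw [hp, Measure.map_map (by fun_prop) (by fun_prop)]
  rfl

/-- The Gaussian characteristic function never vanishes, so convolution with the noise can be
cancelled. An injective Borel map of the line is a measurable embedding, so the law of `u(X)`
determines that of `X`. -/
theorem eq_of_outLaw_eq (hu : Measurable u) (hinj : Function.Injective u)
    (h : outLaw u μ = outLaw u ν) : μ = ν := by
  rw [outLaw_eq_conv hu, outLaw_eq_conv hu] at h
  have := Measure.isProbabilityMeasure_map hu.aemeasurable (μ := μ)
  have := Measure.isProbabilityMeasure_map hu.aemeasurable (μ := ν)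
  have hmap : μ.map u = ν.map u := by
    refine Measure.ext_of_charFun (funext fun t => ?_)
    have ht := congrArg (fun m => charFun m t) h
    simp only [charFun_conv] at ht
    refine mul_right_cancel₀ ?_ ht
    rw [charFun_gaussianReal]
    exact Complex.exp_ne_zero _
  have hu' := hu.measurableEmbedding hinj
  rw [← hu'.comap_map μ, hmap, hu'.comap_map]

end Laws

theorem jointLaw_eq {As β hI : ℝ} (hu : Measurable fun x => hI * sspa As β x)
    (μ : Measure ℝ) [IsProbabilityMeasure μ] :
    jointLaw As β hI μ = μ ⊗ₘ gaussKernel (fun x => hI * sspa As β x) hu :=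
  map_add_noise_eq_compProd hu μ

theorem mutualInfo_le_iff {As β hI B : ℝ} (hB : ∀ x, |hI * sspa As β x| ≤ B)
    (μ ν : Measure ℝ) [IsProbabilityMeasure μ] [IsProbabilityMeasure ν] :
    mutualInfo (jointLaw As β hI ν) ≤ mutualInfo (jointLaw As β hI μ) ↔
      crossEntropy (fun x => hI * sspa As β x) ν ν ≤
        crossEntropy (fun x => hI * sspa As β x) μ μ := by
  have hu : Measurable fun x => hI * sspa As β x := (measurable_sspa As β).const_mul hI
  have hl : 0 < Real.log 2 := Real.log_pos one_lt_two
  obtain ⟨t1, e1⟩ := toReal_klDiv_compProd hu hB (μ := μ)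
  obtain ⟨t2, e2⟩ := toReal_klDiv_compProd hu hB (μ := ν)
  rw [mutualInfo, mutualInfo, jointLaw_eq hu, jointLaw_eq hu, Measure.fst_compProd,
    Measure.fst_compProd, snd_compProd_eq_outLaw, snd_compProd_eq_outLaw,
    ENNReal.div_le_iff (ENNReal.ofReal_pos.2 hl).ne' ENNReal.ofReal_ne_top,
    ENNReal.div_mul_cancel (ENNReal.ofReal_pos.2 hl).ne' ENNReal.ofReal_ne_top,
    ← ENNReal.toReal_le_toReal t2 t1, e1, e2]
  exact sub_le_sub_iff_right _

/-! ### Weak continuity, compactness and existence of a maximiser. -/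

open Filter Topology

theorem integrable_gaussian_mul_quadratic (a b c : ℝ) :
    Integrable fun y : ℝ => a * Real.exp (-(y ^ 2 / 4 - b)) * (y ^ 2 + c) := by
  have h2 : Integrable fun y : ℝ => y ^ 2 * Real.exp (-(1 / 4) * y ^ 2) := by
    have := integrable_rpow_mul_exp_neg_mul_sq (b := 1 / 4) (s := 2) (by norm_num) (by norm_num)
    simpa using this
  have h0 : Integrable fun y : ℝ => Real.exp (-(1 / 4) * y ^ 2) :=
    integrable_exp_neg_mul_sq (by norm_num)
  refine ((h2.add (h0.const_mul c)).const_mul (a * Real.exp b)).congr (ae_of_all _ fun y => ?_)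
  have : Real.exp (-(y ^ 2 / 4 - b)) = Real.exp b * Real.exp (-(1 / 4) * y ^ 2) := by
    rw [← Real.exp_add]; congr 1; ring
  simp only [Pi.add_apply, this]
  ring

/-- Pointwise convergence of output densities suffices: the integrand is dominated by a Gaussian
times a quadratic, whatever the input laws. -/
theorem tendsto_crossEntropy {u : ℝ → ℝ} (hu : Measurable u) {B : ℝ} (hB : ∀ x, |u x| ≤ B)
    {ι : Type*} {l : Filter ι} [l.IsCountablyGenerated] {m n : ι → Measure ℝ}
    [∀ i, IsProbabilityMeasure (m i)] [∀ i, IsProbabilityMeasure (n i)]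
    {μ ν : Measure ℝ} [IsProbabilityMeasure μ] [IsProbabilityMeasure ν]
    (hm : ∀ y, Tendsto (fun i => outDensity u (m i) y) l (𝓝 (outDensity u μ y)))
    (hn : ∀ y, Tendsto (fun i => outDensity u (n i) y) l (𝓝 (outDensity u ν y))) :
    Tendsto (fun i => crossEntropy u (m i) (n i)) l (𝓝 (crossEntropy u μ ν)) := by
  simp only [crossEntropy_eq_integral hu hB]
  refine tendsto_integral_filter_of_dominated_convergence
    (fun y => gaussNorm * Real.exp (-(y ^ 2 / 4 - B ^ 2 / 2)) *
      (y ^ 2 + (B ^ 2 - Real.log gaussNorm)))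
    (.of_forall fun i => ((measurable_outDensity hu).mul
      (measurable_surprisal hu)).aestronglyMeasurable)
    (.of_forall fun i => ae_of_all _ fun y => ?_)
    (integrable_gaussian_mul_quadratic _ _ _) (ae_of_all _ fun y => ?_)
  · rw [norm_mul, Real.norm_of_nonneg (outDensity_pos hu hB y).le]
    exact mul_le_mul (outDensity_le hu hB y) (abs_surprisal_le hu hB y) (norm_nonneg _)
      (mul_nonneg gaussNorm_pos.le (Real.exp_pos _).le)
  · exact (hn y).mul ((hm y).log (outDensity_pos hu hB y).ne').neg

theorem continuous_crossEntropy_self {u : ℝ → ℝ} (hu : Continuous u) {B : ℝ}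
    (hB : ∀ x, |u x| ≤ B) :
    Continuous fun μ : ProbabilityMeasure ℝ => crossEntropy u (μ : Measure ℝ) μ := by
  refine continuous_iff_continuousAt.2 fun μ => ?_
  have h : ∀ y, Tendsto (fun m : ProbabilityMeasure ℝ => outDensity u (m : Measure ℝ) y) (𝓝 μ)
      (𝓝 (outDensity u (μ : Measure ℝ) y)) := fun y => by
    let f : BoundedContinuousFunction ℝ ℝ := BoundedContinuousFunction.ofNormedAddCommGroup
      (fun x => gaussianPDFReal (u x) 1 y)
      (continuous_uncurry_gaussianPDFReal.comp (hu.prodMk continuous_const)) gaussNorm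
      fun x => by
        rw [Real.norm_of_nonneg (gaussianPDFReal_nonneg _ _ _)]
        exact gaussianPDFReal_le_gaussNorm _ _
    exact ProbabilityMeasure.tendsto_iff_forall_integral_tendsto.1 tendsto_id f
  exact tendsto_crossEntropy hu.measurable hB h h

/-- The peak constraint gives tightness. Under it `x²` agrees with the bounded continuous function
`min (x²) (A²)`, so the power constraint is weakly closed. -/
theorem isCompact_feasible (σ A : ℝ) :
    IsCompact {μ : ProbabilityMeasure ℝ | Feasible σ A (μ : Measure ℝ)} := by
  -- Constant sequences: no mass at all is allowed outside the single compact set `[-A, A]`.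
  have hK := isCompact_setOfPred_probabilityMeasure_mass_eq_compl_isCompact_le (E := ℝ)
    (u := fun _ => 0) (K := fun _ => Set.Icc (-A) A) tendsto_const_nhds
    (fun _ => isCompact_Icc) (.inl inferInstance)
  let f : BoundedContinuousFunction ℝ ℝ := BoundedContinuousFunction.ofNormedAddCommGroup
    (fun x => min (x ^ 2) (A ^ 2)) (by fun_prop) (A ^ 2)
    fun x => by
      rw [Real.norm_of_nonneg (by positivity)]
      exact min_le_right _ _
  have hC : IsClosed {μ : ProbabilityMeasure ℝ | ∫ x, f x ∂(μ : Measure ℝ) ≤ σ ^ 2} := by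
    refine isClosed_le (continuous_iff_continuousAt.2 fun μ => ?_) continuous_const
    exact ProbabilityMeasure.tendsto_iff_forall_integral_tendsto.1 tendsto_id f
  convert hK.inter_right hC using 1
  ext μ
  have key : (μ (Set.Icc (-A) A)ᶜ ≤ 0) ↔ ∀ᵐ x ∂(μ : Measure ℝ), |x| ≤ A := by
    rw [nonpos_iff_eq_zero, ProbabilityMeasure.null_iff_toMeasure_null, ae_iff]
    congr! 2
    ext x
    simp [abs_le]
  have int (h : ∀ᵐ x ∂(μ : Measure ℝ), |x| ≤ A) :
      ∫ x, f x ∂(μ : Measure ℝ) = ∫ x, x ^ 2 ∂(μ : Measure ℝ) := by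
    refine integral_congr_ae ?_
    filter_upwards [h] with x hx
    exact min_eq_left (sq_le_sq' (neg_le_of_abs_le hx) (le_of_abs_le hx))
  constructor
  · rintro ⟨_, h1, h2⟩
    exact ⟨fun _ => key.2 h1, (int h1).le.trans h2⟩
  · rintro ⟨h1, h2⟩
    have h1 := key.1 (h1 0)
    exact ⟨inferInstance, h1, (int h1).ge.trans h2⟩

theorem feasible_dirac {σ A x : ℝ} (hx : |x| ≤ A) (hσ : x ^ 2 ≤ σ ^ 2) :
    Feasible σ A (Measure.dirac x) :=
  ⟨inferInstance, by rw [ae_dirac_eq]; exact hx, by simpa using hσ⟩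

theorem exists_isMaxOn_crossEntropy {u : ℝ → ℝ} (hu : Continuous u) {B : ℝ}
    (hB : ∀ x, |u x| ≤ B) {σ A : ℝ} (hA : 0 ≤ A) :
    ∃ μ : Measure ℝ, Feasible σ A μ ∧
      ∀ ν : Measure ℝ, Feasible σ A ν → crossEntropy u ν ν ≤ crossEntropy u μ μ := by
  have hne : {μ : ProbabilityMeasure ℝ | Feasible σ A (μ : Measure ℝ)}.Nonempty :=
    ⟨⟨Measure.dirac 0, inferInstance⟩, feasible_dirac (by simpa using hA) (by simpa using sq_nonneg σ)⟩
  obtain ⟨μ, hμ, hmax⟩ := (isCompact_feasible σ A).exists_isMaxOn hne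
    (continuous_crossEntropy_self hu hB).continuousOn
  refine ⟨μ, hμ, fun ν hν => ?_⟩
  have := hν.isProbabilityMeasure
  exact hmax (show (⟨ν, this⟩ : ProbabilityMeasure ℝ) ∈ _ from hν)

/-! ### Mixtures, first-order optimality and uniqueness. -/

/-- The mixture `(1 - t) μ + t ν`. -/
noncomputable def mix (t : ℝ) (μ ν : Measure ℝ) : Measure ℝ :=
  ENNReal.ofReal (1 - t) • μ + ENNReal.ofReal t • ν

section Mix

variable {t : ℝ} (h0 : 0 ≤ t) (h1 : t ≤ 1) {μ ν : Measure ℝ}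

include h0 h1 in
theorem isProbabilityMeasure_mix [IsProbabilityMeasure μ] [IsProbabilityMeasure ν] :
    IsProbabilityMeasure (mix t μ ν) := by
  constructor
  simp only [mix, Measure.add_apply, Measure.smul_apply, measure_univ, smul_eq_mul, mul_one]
  rw [← ENNReal.ofReal_add (by linarith) h0]
  simp

include h0 h1 in
theorem integral_mix {f : ℝ → ℝ} (hμ : Integrable f μ) (hν : Integrable f ν) :
    ∫ x, f x ∂mix t μ ν = (1 - t) * ∫ x, f x ∂μ + t * ∫ x, f x ∂ν := by
  rw [mix, integral_add_measure (hμ.smul_measure ENNReal.ofReal_ne_top)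
    (hν.smul_measure ENNReal.ofReal_ne_top), integral_smul_measure, integral_smul_measure,
    ENNReal.toReal_ofReal (by linarith), ENNReal.toReal_ofReal h0, smul_eq_mul, smul_eq_mul]

theorem Feasible.integrable_sq {σ A : ℝ} (h : Feasible σ A μ) :
    Integrable (fun x => x ^ 2) μ := by
  have := h.isProbabilityMeasure
  refine Integrable.of_bound (by fun_prop) (A ^ 2) ?_
  filter_upwards [h.peak] with x hx
  rw [Real.norm_of_nonneg (by positivity)]
  exact sq_le_sq' (neg_le_of_abs_le hx) (le_of_abs_le hx)

include h0 h1 in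
-- The components may have their own power budgets, so a point violating the power constraint can be
-- balanced by one with power to spare.
theorem Feasible.mix_of {σ A τ ρ : ℝ} (hμ : Feasible τ A μ) (hν : Feasible ρ A ν)
    (h : (1 - t) * ∫ x, x ^ 2 ∂μ + t * ∫ x, x ^ 2 ∂ν ≤ σ ^ 2) : Feasible σ A (mix t μ ν) := by
  have := hμ.isProbabilityMeasure
  have := hν.isProbabilityMeasure
  refine ⟨isProbabilityMeasure_mix h0 h1, ?_, ?_⟩
  · rw [mix, ae_add_measure_iff]
    exact ⟨Measure.ae_smul_measure hμ.peak _, Measure.ae_smul_measure hν.peak _⟩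
  · rwa [integral_mix h0 h1 hμ.integrable_sq hν.integrable_sq]

include h0 h1 in
theorem Feasible.mix {σ A : ℝ} (hμ : Feasible σ A μ) (hν : Feasible σ A ν) :
    Feasible σ A (mix t μ ν) :=
  hμ.mix_of h0 h1 hν (by nlinarith [hμ.averagePower, hν.averagePower])

end Mix

/-- A directional derivative without differentiation. For `m = (1-t)μ + tν`, write `H(μ,ν)` for the
cross entropy. Then `(1-t) H(m,μ) + t H(m,ν) = H(m,m) ≤ H(μ,μ) ≤ H(m,μ)` by linearity, optimality
and Gibbs. Hence `H(m,ν) ≤ H(μ,μ)`; let `t → 0`. -/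
theorem crossEntropy_le_of_isMax {u : ℝ → ℝ} (hu : Measurable u) {B : ℝ}
    (hB : ∀ x, |u x| ≤ B) {σ A : ℝ} {μ : Measure ℝ} (hμ : Feasible σ A μ)
    (hmax : ∀ ν : Measure ℝ, Feasible σ A ν → crossEntropy u ν ν ≤ crossEntropy u μ μ)
    {ν : Measure ℝ} (hν : Feasible σ A ν) : crossEntropy u μ ν ≤ crossEntropy u μ μ := by
  have := hμ.isProbabilityMeasure
  have := hν.isProbabilityMeasure
  let t : ℕ → ℝ := fun k => 1 / ((k : ℝ) + 1)
  have t0 (k) : 0 < t k := Nat.one_div_pos_of_nat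
  have t1 (k) : t k ≤ 1 := by
    simp only [t]
    rw [div_le_one (by positivity)]
    linarith [k.cast_nonneg (α := ℝ)]
  have hp (k) : IsProbabilityMeasure (mix (t k) μ ν) := isProbabilityMeasure_mix (t0 k).le (t1 k)
  have hlim : Tendsto (fun k => crossEntropy u (mix (t k) μ ν) ν) atTop
      (𝓝 (crossEntropy u μ ν)) := by
    refine tendsto_crossEntropy hu hB (fun y => ?_) (fun y => tendsto_const_nhds)
    have ht : Tendsto t atTop (𝓝 0) := tendsto_one_div_add_atTop_nhds_zero_nat
    have := ((ht.const_sub 1).mul_const (outDensity u μ y)).add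
      (ht.mul_const (outDensity u ν y))
    simp only [sub_zero, one_mul, zero_mul, add_zero] at this
    refine this.congr fun k => ?_
    exact (integral_mix (t0 k).le (t1 k) (integrable_gaussianPDFReal_input hu μ y)
      (integrable_gaussianPDFReal_input hu ν y)).symm
  refine le_of_tendsto hlim (.of_forall fun k => ?_)
  have e : crossEntropy u (mix (t k) μ ν) (mix (t k) μ ν) =
      (1 - t k) * crossEntropy u (mix (t k) μ ν) μ + t k * crossEntropy u (mix (t k) μ ν) ν :=
    integral_mix (t0 k).le (t1 k) (integrable_meanSurprisal hu hB μ)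
      (integrable_meanSurprisal hu hB ν)
  have hle := hmax _ (hμ.mix (t0 k).le (t1 k) hν)
  have hg := crossEntropy_self_le hu hB (μ := mix (t k) μ ν) (ν := μ)
  have := mul_le_mul_of_nonneg_left hg (sub_nonneg.2 (t1 k))
  refine le_of_mul_le_mul_left ?_ (t0 k)
  linarith

/-- Two maximisers of the output entropy coincide if the channel map is injective. -/
theorem eq_of_isMax {u : ℝ → ℝ} (hu : Measurable u) (hinj : Function.Injective u) {B : ℝ}
    (hB : ∀ x, |u x| ≤ B) {σ A : ℝ} {μ : Measure ℝ} (hμ : Feasible σ A μ)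
    (hmax : ∀ ν : Measure ℝ, Feasible σ A ν → crossEntropy u ν ν ≤ crossEntropy u μ μ)
    {ν : Measure ℝ} (hν : Feasible σ A ν) (hle : crossEntropy u μ μ ≤ crossEntropy u ν ν) :
    ν = μ := by
  have := hμ.isProbabilityMeasure
  have := hν.isProbabilityMeasure
  exact eq_of_outLaw_eq hu hinj (outLaw_eq_of_crossEntropy_le hu hB
    ((crossEntropy_le_of_isMax hu hB hμ hmax hν).trans hle))

/-! ### The Lagrange multiplier of the power constraint. -/

/-- Karush-Kuhn-Tucker conditions: a function whose mean is nonpositive under all feasible laws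
is dominated by a multiple of the power constraint. -/
theorem exists_multiplier {σ A : ℝ} (hσ : σ ≠ 0) (hA : 0 ≤ A) {f : ℝ → ℝ}
    (h : ∀ ν : Measure ℝ, Feasible σ A ν → ∫ x, f x ∂ν ≤ 0) :
    ∃ l : ℝ, 0 ≤ l ∧ ∀ x, |x| ≤ A → f x ≤ l * (x ^ 2 - σ ^ 2) := by
  have hσ2 : 0 < σ ^ 2 := by positivity
  have hin (x) (hx : |x| ≤ A) (hq : x ^ 2 ≤ σ ^ 2) : f x ≤ 0 := by
    simpa using h _ (feasible_dirac hx hq)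
  have hpair (x) (hx : |x| ≤ A) (hq : σ ^ 2 < x ^ 2) (z) (hz : |z| ≤ A) (hqz : z ^ 2 < σ ^ 2) :
      f x / (x ^ 2 - σ ^ 2) ≤ f z / (z ^ 2 - σ ^ 2) := by
    have hd : 0 < x ^ 2 - z ^ 2 := by linarith
    -- The weight for which the two-point law on `z` and `x` has power exactly `σ²`.
    let t := (σ ^ 2 - z ^ 2) / (x ^ 2 - z ^ 2)
    have t0 : 0 ≤ t := div_nonneg (by linarith) hd.le
    have t1 : t ≤ 1 := by rw [div_le_one hd]; linarith
    have ht : t * (x ^ 2 - z ^ 2) = σ ^ 2 - z ^ 2 := div_mul_cancel₀ _ hd.ne'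
    have hint := h _ ((feasible_dirac hz (le_refl (z ^ 2))).mix_of (σ := σ) t0 t1
      (feasible_dirac hx (le_refl (x ^ 2))) (by simp only [integral_dirac]; linarith))
    rw [integral_mix t0 t1 (integrable_dirac (by simp)) (integrable_dirac (by simp)),
      integral_dirac, integral_dirac] at hint
    have h2 : (x ^ 2 - σ ^ 2) * f z + (σ ^ 2 - z ^ 2) * f x ≤ 0 := by
      have := mul_nonpos_of_nonneg_of_nonpos hd.le hint
      have e : (x ^ 2 - z ^ 2) * ((1 - t) * f z + t * f x) =
          (x ^ 2 - σ ^ 2) * f z + (σ ^ 2 - z ^ 2) * f x := by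
        linear_combination (f x - f z) * ht
      linarith
    rw [← neg_div_neg_eq (f z), div_le_div_iff₀ (by linarith) (by linarith)]
    linarith
  have h0 : |(0 : ℝ)| ≤ A := by simpa using hA
  have h0' : (0 : ℝ) ^ 2 < σ ^ 2 := by simpa using hσ2
  -- The multiplier is the supremum of the slopes from points above the power limit; by `hpair` it
  -- lies below every slope from points under it. Inserting `0` makes it nonnegative, and `z = 0`,
  -- strictly below the limit as `σ ≠ 0`, bounds `S`.
  let S : Set ℝ := insert 0 ((fun x => f x / (x ^ 2 - σ ^ 2)) '' {x | |x| ≤ A ∧ σ ^ 2 < x ^ 2})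
  have hub (z) (hz : |z| ≤ A) (hqz : z ^ 2 < σ ^ 2) : f z / (z ^ 2 - σ ^ 2) ∈ upperBounds S := by
    rintro _ (rfl | ⟨x, ⟨hx, hq⟩, rfl⟩)
    · exact div_nonneg_of_nonpos (hin z hz hqz.le) (by linarith)
    · exact hpair x hx hq z hz hqz
  have hbdd : BddAbove S := ⟨_, hub 0 h0 h0'⟩
  refine ⟨sSup S, le_csSup hbdd (Set.mem_insert _ _), fun x hx => ?_⟩
  rcases lt_trichotomy (x ^ 2) (σ ^ 2) with hq | hq | hq
  · have := csSup_le (Set.insert_nonempty _ _) (hub x hx hq)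
    exact (le_div_iff_of_neg (by linarith)).1 this
  · rw [hq, sub_self, mul_zero]
    exact hin x hx hq.le
  · have := le_csSup hbdd (Set.mem_insert_of_mem _ ⟨x, ⟨hx, hq⟩, rfl⟩)
    exact (div_le_iff₀ (by linarith)).1 this

/-! ### The amplifier characteristic. -/

section Sspa

variable {As β : ℝ} (hAs : 0 < As) (hβ : 0 < β)

include hAs in
theorem one_le_sspa_base (r : ℝ) : 1 ≤ 1 + (|r| / As) ^ (2 * β) := by
  have : 0 ≤ (|r| / As) ^ (2 * β) := by positivity
  linarith

include hAs in
theorem sspa_denom_pos (r : ℝ) : 0 < (1 + (|r| / As) ^ (2 * β)) ^ (1 / (2 * β)) :=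
  Real.rpow_pos_of_pos (zero_lt_one.trans_le (one_le_sspa_base hAs r)) _

include hAs hβ in
theorem continuous_sspa_denom :
    Continuous fun r => (1 + (|r| / As) ^ (2 * β)) ^ (1 / (2 * β)) := by
  refine Continuous.rpow_const ?_ fun r => .inl
    (zero_lt_one.trans_le (one_le_sspa_base hAs r)).ne'
  exact continuous_const.add
    ((continuous_abs.div_const _).rpow_const fun _ => .inr (by positivity))

include hAs hβ in
theorem continuous_sspa : Continuous (sspa As β) :=
  continuous_id.div (continuous_sspa_denom hAs hβ) fun r => (sspa_denom_pos hAs r).ne'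

theorem sspa_zero : sspa As β 0 = 0 := by simp [sspa]

theorem sspa_neg (r : ℝ) : sspa As β (-r) = -sspa As β r := by
  simp [sspa, neg_div]

include hAs hβ in
-- In the variable `w = (|r| / As) ^ (2β)` the amplifier is `w ↦ w / (1 + w)`; saturation and
-- injectivity are read off from this.
theorem abs_sspa_rpow (r : ℝ) :
    (|sspa As β r| / As) ^ (2 * β) =
      (|r| / As) ^ (2 * β) / (1 + (|r| / As) ^ (2 * β)) := by
  have h1 : 0 ≤ 1 + (|r| / As) ^ (2 * β) := by positivity
  rw [sspa, abs_div, abs_of_pos (sspa_denom_pos hAs r), div_right_comm,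
    Real.div_rpow (by positivity) (sspa_denom_pos hAs r).le, ← Real.rpow_mul h1,
    one_div_mul_cancel (by positivity), Real.rpow_one]

include hAs hβ in
theorem abs_sspa_le (r : ℝ) : |sspa As β r| ≤ As := by
  have h := abs_sspa_rpow hAs hβ r
  have h1 : 0 ≤ (|r| / As) ^ (2 * β) := by positivity
  have h2 : (|sspa As β r| / As) ^ (2 * β) ≤ 1 := by
    rw [h, div_le_one (by positivity)]; linarith
  have h3 : |sspa As β r| / As ≤ 1 := by
    by_contra hc
    exact absurd h2 (not_le.2 (Real.one_lt_rpow (not_le.1 hc) (by positivity)))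
  exact (div_le_one hAs).1 h3

include hAs hβ in
theorem sspa_injective : Function.Injective (sspa As β) := by
  intro r s h
  have e : |r| = |s| := by
    have h1 := abs_sspa_rpow hAs hβ r
    rw [h, abs_sspa_rpow hAs hβ s] at h1
    have hr : 0 ≤ (|r| / As) ^ (2 * β) := by positivity
    have hs : 0 ≤ (|s| / As) ^ (2 * β) := by positivity
    rw [div_eq_div_iff (by positivity) (by positivity)] at h1
    have h2 : (|r| / As) ^ (2 * β) = (|s| / As) ^ (2 * β) := by linarith
    have h3 := Real.rpow_left_injOn (x := 2 * β) (by positivity)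
      (show 0 ≤ |r| / As by positivity) (show 0 ≤ |s| / As by positivity) h2
    exact (div_left_inj' hAs.ne').1 h3
  unfold sspa at h
  rw [e] at h
  exact (div_left_inj' (sspa_denom_pos hAs s).ne').1 h

theorem sspa_pos_eq {r : ℝ} (hr : 0 < r) :
    sspa As β r = r / (1 + (r / As) ^ (2 * β)) ^ (1 / (2 * β)) := by
  rw [sspa, abs_of_pos hr]

include hAs in
theorem sspa_pos {r : ℝ} (hr : 0 < r) : 0 < sspa As β r :=
  div_pos hr (sspa_denom_pos hAs r)

include hAs hβ in
theorem sspa_lt_self {r : ℝ} (hr : 0 < r) : sspa As β r < r := by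
  refine div_lt_self hr (Real.one_lt_rpow ?_ (by positivity))
  have : 0 < (|r| / As) ^ (2 * β) := by positivity
  linarith

theorem _root_.AnalyticAt.rpow_const {f : ℝ → ℝ} {x : ℝ} (hf : AnalyticAt ℝ f x) (h : 0 < f x)
    (p : ℝ) : AnalyticAt ℝ (fun z => f z ^ p) x := by
  refine ((hf.log h).mul (analyticAt_const (v := p))).rexp'.congr ?_
  filter_upwards [hf.continuousAt.eventually (lt_mem_nhds h)] with z hz
  exact (Real.rpow_def_of_pos hz p).symm

include hAs in
theorem analyticAt_sspa {r : ℝ} (hr : 0 < r) : AnalyticAt ℝ (sspa As β) r := by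
  have hd : AnalyticAt ℝ (fun z : ℝ => z / As) r := analyticAt_id.div_const
  have hw := analyticAt_const (v := (1 : ℝ)).add (hd.rpow_const (div_pos hr hAs) (2 * β))
  have hp : 0 < 1 + (r / As) ^ (2 * β) := by positivity
  have hD := hw.rpow_const hp (1 / (2 * β))
  refine (analyticAt_id.div hD (Real.rpow_pos_of_pos hp _).ne').congr ?_
  filter_upwards [lt_mem_nhds hr] with z hz
  exact (sspa_pos_eq hz).symm

end Sspa

/-! ### Isolated zeros and the behaviour at the origin. -/

/-- Distinct powers cannot be balanced infinitely often near zero. -/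
theorem not_frequently_rpow_mul_eq_of_lt {a b p q : ℝ} {P Q : ℝ → ℝ} (hab : a < b) (hp : p ≠ 0)
    (hP : Tendsto P (𝓝[>] 0) (𝓝 p)) (hQ : Tendsto Q (𝓝[>] 0) (𝓝 q)) :
    ¬ ∃ᶠ x in 𝓝[>] (0 : ℝ), x ^ a * P x = x ^ b * Q x := by
  rw [not_frequently]
  have h0 : Tendsto (fun x : ℝ => x ^ (b - a)) (𝓝[>] 0) (𝓝 0) := by
    have := (Real.continuousAt_rpow_const 0 (b - a) (.inr (by linarith))).tendsto
    rw [Real.zero_rpow (by linarith)] at this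
    exact this.mono_left nhdsWithin_le_nhds
  have hl := hP.sub (h0.mul hQ)
  rw [zero_mul, sub_zero] at hl
  filter_upwards [hl.eventually_ne hp, self_mem_nhdsWithin] with x hx hx0 he
  have hx0 : 0 < x := hx0
  have e : x ^ b = x ^ a * x ^ (b - a) := by
    rw [← Real.rpow_add hx0, add_sub_cancel]
  rw [e, mul_assoc] at he
  exact hx (sub_eq_zero.2 (mul_left_cancel₀ (Real.rpow_pos_of_pos hx0 a).ne' he))

theorem not_frequently_rpow_mul_eq {a b p q : ℝ} {P Q : ℝ → ℝ} (hab : a ≠ b) (hp : p ≠ 0)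
    (hq : q ≠ 0) (hP : Tendsto P (𝓝[>] 0) (𝓝 p)) (hQ : Tendsto Q (𝓝[>] 0) (𝓝 q)) :
    ¬ ∃ᶠ x in 𝓝[>] (0 : ℝ), x ^ a * P x = x ^ b * Q x := by
  rcases hab.lt_or_gt with h | h
  · exact not_frequently_rpow_mul_eq_of_lt h hp hP hQ
  · simpa only [eq_comm] using not_frequently_rpow_mul_eq_of_lt h hq hQ hP

section Zeros

variable {As β : ℝ} {G : ℝ → ℝ} {l : ℝ}

/-- The amplifier is analytic on the positive half-line, so the equality would hold on all of it.
But it takes values in `[-As, As]`, where `G` is bounded, while `l * x ^ 2` is not. -/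
theorem not_frequently_eq_sq_of_pos (hAs : 0 < As) (hβ : 0 < β)
    (hG : AnalyticOnNhd ℝ G Set.univ) (hl : 0 < l) {x₀ : ℝ} (hx₀ : 0 < x₀) :
    ¬ ∃ᶠ x in 𝓝[≠] x₀, G (sspa As β x) = l * x ^ 2 := by
  intro hfr
  have h1 : AnalyticOnNhd ℝ (fun x => G (sspa As β x)) (Set.Ioi 0) := fun x hx =>
    (hG _ trivial).comp (analyticAt_sspa hAs hx)
  have h2 : AnalyticOnNhd ℝ (fun x : ℝ => l * x ^ 2) (Set.Ioi 0) := fun x _ => by fun_prop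
  have heq := h1.eqOn_of_preconnected_of_frequently_eq h2 isPreconnected_Ioi hx₀ hfr
  obtain ⟨M, hM⟩ := (isCompact_Icc (a := -As) (b := As)).bddAbove_image
    (hG.continuousOn.mono (Set.subset_univ _))
  have hb (x : ℝ) (hx : 0 < x) : l * x ^ 2 ≤ M := by
    exact (heq hx).ge.trans (hM ⟨_, abs_le.1 (abs_sspa_le hAs hβ x), rfl⟩)
  have ht : Tendsto (fun x : ℝ => l * x ^ 2) atTop atTop :=
    (tendsto_pow_atTop two_ne_zero).const_mul_atTop hl
  obtain ⟨x, hx0, hx⟩ := ((eventually_gt_atTop 0).and (ht.eventually_gt_atTop M)).exists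
  exact absurd (hb x hx0) (not_le.2 hx)

theorem frequently_pos_of_natCast (hβ : 0 < β)
    (hG : AnalyticOnNhd ℝ G Set.univ) {k : ℕ} (hk : 2 * β = k)
    (hfr : ∃ᶠ x in 𝓝[>] (0 : ℝ), G (sspa As β x) = l * x ^ 2) :
    ∃ x₀ > 0, ∃ᶠ x in 𝓝[≠] x₀, G (sspa As β x) = l * x ^ 2 := by
  have hk0 : k ≠ 0 := by rintro rfl; simp at hk; exact hβ.ne' hk
  -- The positive branch without the absolute value: analytic at `0`, and in general equal to `sspa`
  -- only for `x ≥ 0`.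
  let d : ℝ → ℝ := fun x => x / (1 + (x / As) ^ k) ^ (1 / (2 * β))
  have hd (x : ℝ) (hx : 0 < x) : sspa As β x = d x := by
    rw [sspa_pos_eq hx, hk, Real.rpow_natCast, ← hk]
  have hda : AnalyticAt ℝ d 0 := by
    have hw : AnalyticAt ℝ (fun x : ℝ => 1 + (x / As) ^ k) 0 := by
      have hd : AnalyticAt ℝ (fun z : ℝ => z / As) 0 := analyticAt_id.div_const
      exact analyticAt_const.add (hd.pow k)
    have hp : 0 < 1 + ((0 : ℝ) / As) ^ k := by simp [hk0]
    exact analyticAt_id.div (hw.rpow_const hp _) (Real.rpow_pos_of_pos hp _).ne'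
  have h1 : AnalyticAt ℝ (fun x => G (d x)) 0 := (hG _ trivial).comp hda
  have h2 : AnalyticAt ℝ (fun x : ℝ => l * x ^ 2) 0 := by fun_prop
  have hev : ∀ᶠ x in 𝓝 (0 : ℝ), G (d x) = l * x ^ 2 := by
    rw [← h1.frequently_eq_iff_eventually_eq h2]
    have := (hfr.and_eventually self_mem_nhdsWithin).mono
      fun x (hx : _ ∧ x ∈ Set.Ioi (0 : ℝ)) => hd x hx.2 ▸ hx.1
    exact this.filter_mono (nhdsGT_le_nhdsNE 0)
  have hev' : ∀ᶠ x₀ in 𝓝[>] (0 : ℝ), ∀ᶠ x in 𝓝 x₀, G (d x) = l * x ^ 2 :=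
    hev.eventually_nhds.filter_mono nhdsWithin_le_nhds
  obtain ⟨x₀, hx₀, hpos⟩ := (hev'.and self_mem_nhdsWithin).exists
  have hpos : 0 < x₀ := hpos
  refine ⟨x₀, hpos, Eventually.frequently ?_⟩
  refine Eventually.filter_mono nhdsWithin_le_nhds ?_
  filter_upwards [hx₀, lt_mem_nhds hpos] with x hx hx0
  rw [hd x hx0, hx]

/-- For non-integer `2β`, rewrite the equality as `G(s) - l s² = l (x² - s²)` with `s = d(x)`. The
left side vanishes to an integer order in `x` or identically, while the right side is asymptotic to
a nonzero multiple of `x^(2+2β)`. -/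
theorem not_frequently_eq_sq_nhdsGT (hAs : 0 < As) (hβ : 0 < β)
    (hG : AnalyticOnNhd ℝ G Set.univ) (hl : 0 < l) :
    ¬ ∃ᶠ x in 𝓝[>] (0 : ℝ), G (sspa As β x) = l * x ^ 2 := by
  intro hfr
  by_cases hk : ∃ k : ℕ, 2 * β = k
  · obtain ⟨k, hk⟩ := hk
    obtain ⟨x₀, hx₀, h⟩ := frequently_pos_of_natCast hβ hG hk hfr
    exact not_frequently_eq_sq_of_pos hAs hβ hG hl hx₀ h
  have hs : Tendsto (sspa As β) (𝓝[>] 0) (𝓝 0) := by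
    have := (continuous_sspa hAs hβ).tendsto 0
    rw [sspa_zero] at this
    exact this.mono_left nhdsWithin_le_nhds
  have hE : AnalyticAt ℝ (fun s => G s - l * s ^ 2) 0 := (hG 0 trivial).sub (by fun_prop)
  by_cases hz : ∀ᶠ s in 𝓝 (0 : ℝ), G s - l * s ^ 2 = 0
  -- If `G(s) = l s²` near `0`, the equality would force `d(x)² = x²`, against `0 < d(x) < x`.
  · obtain ⟨x, ⟨hx, hx0⟩, hxz⟩ :=
      ((hfr.and_eventually self_mem_nhdsWithin).and_eventually (hs.eventually hz)).exists
    have hx0 : 0 < x := hx0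
    have h1 := sspa_pos hAs (β := β) hx0
    have h2 := sspa_lt_self hAs hβ hx0
    have h3 : sspa As β x ^ 2 < x ^ 2 := by gcongr
    have := mul_lt_mul_of_pos_left h3 hl
    linarith
  obtain ⟨m, g, hg, hg0, hge⟩ := hE.exists_eventuallyEq_pow_smul_nonzero_iff.2 hz
  -- With these, `d(x) = x R(x)` and `x² - d(x)² = x² T(x) ψ(x)` for `x > 0`. Here `ψ` is a
  -- difference quotient at `0` of `t ↦ 1 - (1 + t)^(-1/β)`, hence tends to `1/β`.
  let T : ℝ → ℝ := fun x => (x / As) ^ (2 * β)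
  let ψ : ℝ → ℝ := fun x => (T x)⁻¹ * (1 - (1 + T x) ^ (-(1 / β)))
  let R : ℝ → ℝ := fun x => ((1 + (|x| / As) ^ (2 * β)) ^ (1 / (2 * β)))⁻¹
  have hT : Tendsto T (𝓝[>] 0) (𝓝[>] 0) := by
    refine tendsto_nhdsWithin_of_tendsto_nhds_of_eventually_within _ ?_ ?_
    · have hc : Continuous T :=
        (continuous_id.div_const As).rpow_const fun _ => .inr (by positivity)
      have := hc.tendsto 0
      have h0 : T 0 = 0 := by
        simp only [T, zero_div]
        exact Real.zero_rpow (by positivity)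
      rw [h0] at this
      exact this.mono_left nhdsWithin_le_nhds
    · filter_upwards [self_mem_nhdsWithin] with x hx
      have hx : 0 < x := hx
      exact Real.rpow_pos_of_pos (div_pos hx hAs) _
  have hψ : Tendsto ψ (𝓝[>] 0) (𝓝 (1 / β)) := by
    have hder : HasDerivAt (fun t : ℝ => 1 - (1 + t) ^ (-(1 / β))) (1 / β) 0 := by
      have := ((hasDerivAt_id (0 : ℝ)).const_add 1).rpow_const (p := -(1 / β)) (.inl (by simp))
      simpa using this.const_sub 1
    have := hder.tendsto_slope_zero_right.comp hT
    refine this.congr fun x => ?_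
    simp [ψ]
  have hR : Tendsto R (𝓝[>] 0) (𝓝 1) := by
    have hc : Continuous R :=
      (continuous_sspa_denom hAs hβ).inv₀ fun r => (sspa_denom_pos hAs r).ne'
    have := hc.tendsto 0
    have h0 : R 0 = 1 := by
      simp only [R, abs_zero, zero_div]
      rw [Real.zero_rpow (by positivity)]
      simp
    rw [h0] at this
    exact this.mono_left nhdsWithin_le_nhds
  have hQ : Tendsto (fun x => R x ^ m * g (sspa As β x)) (𝓝[>] 0) (𝓝 (g 0)) := by
    simpa using (hR.pow m).mul (hg.continuousAt.tendsto.comp hs)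
  have hP := hψ.const_mul (l * As ^ (-(2 * β)))
  have hmne : 2 + 2 * β ≠ (m : ℝ) := by
    intro h
    have hm : 2 ≤ m := by
      have : (2 : ℝ) ≤ m := by linarith
      exact_mod_cast this
    exact hk ⟨m - 2, by push_cast [Nat.cast_sub hm]; linarith⟩
  have hp0 : l * As ^ (-(2 * β)) * (1 / β) ≠ 0 := by positivity
  refine not_frequently_rpow_mul_eq hmne hp0 hg0 hP hQ ?_
  refine ((hfr.and_eventually self_mem_nhdsWithin).and_eventually (hs.eventually hge)).mono ?_
  rintro x ⟨⟨hx, hx0⟩, hxe⟩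
  have hx0 : 0 < x := hx0
  have hTx : 0 < T x := Real.rpow_pos_of_pos (div_pos hx0 hAs) _
  have hsx : sspa As β x = x * R x := div_eq_mul_inv _ _
  have hR2 : R x ^ 2 = (1 + T x) ^ (-(1 / β)) := by
    simp only [R, T, abs_of_pos hx0]
    rw [← Real.rpow_neg (by positivity), ← Real.rpow_natCast, ← Real.rpow_mul (by positivity)]
    congr 1
    push_cast
    field_simp
  have hTe : As ^ (-(2 * β)) * x ^ (2 * β) = T x := by
    simp only [T]
    rw [Real.div_rpow hx0.le hAs.le, Real.rpow_neg hAs.le]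
    field_simp
  have hxp : x ^ (2 + 2 * β) = x ^ 2 * x ^ (2 * β) := by
    rw [Real.rpow_add hx0, Real.rpow_two]
  have hψx : T x * ψ x = 1 - R x ^ 2 := by
    simp only [ψ]
    rw [mul_inv_cancel_left₀ hTx.ne', hR2]
  rw [hx, sub_zero, smul_eq_mul] at hxe
  have hr : x ^ (m : ℝ) * (R x ^ m * g (sspa As β x)) = l * x ^ 2 - l * (x * R x) ^ 2 := by
    rw [Real.rpow_natCast, ← mul_assoc, ← mul_pow, ← hsx, hxe]
  rw [hr, hxp]
  calc x ^ 2 * x ^ (2 * β) * (l * As ^ (-(2 * β)) * ψ x)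
      = l * x ^ 2 * ((As ^ (-(2 * β)) * x ^ (2 * β)) * ψ x) := by ring
    _ = l * x ^ 2 - l * (x * R x) ^ 2 := by rw [hTe, hψx]; ring

theorem not_frequently_eq_sq (hAs : 0 < As) (hβ : 0 < β)
    (hG : AnalyticOnNhd ℝ G Set.univ) (hl : 0 < l) (x₀ : ℝ) :
    ¬ ∃ᶠ x in 𝓝[≠] x₀, G (sspa As β x) = l * x ^ 2 := by
  have hG' : AnalyticOnNhd ℝ (fun s => G (-s)) Set.univ := fun s _ =>
    (hG (-s) trivial).comp analyticAt_id.neg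
  rcases lt_trichotomy x₀ 0 with h | rfl | h
  · intro hfr
    have ht : Tendsto (fun x : ℝ => -x) (𝓝[≠] x₀) (𝓝[≠] (-x₀)) :=
      continuous_neg.continuousWithinAt.tendsto_nhdsWithin fun x hx h => hx (neg_injective h)
    refine not_frequently_eq_sq_of_pos hAs hβ hG' hl (neg_pos.2 h) (ht.frequently ?_)
    simpa only [sspa_neg, neg_neg, neg_sq] using hfr
  · rw [← nhdsLT_sup_nhdsGT, frequently_sup, not_or]
    refine ⟨fun hfr => ?_, not_frequently_eq_sq_nhdsGT hAs hβ hG hl⟩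
    have ht : Tendsto (fun x : ℝ => -x) (𝓝[<] 0) (𝓝[>] 0) := by
      simpa using tendsto_neg_nhdsLT (a := (0 : ℝ))
    refine not_frequently_eq_sq_nhdsGT hAs hβ hG' hl (ht.frequently ?_)
    simpa only [sspa_neg, neg_neg, neg_sq] using hfr
  · exact not_frequently_eq_sq_of_pos hAs hβ hG hl h

/-- By compactness an infinite set would have an accumulation point. For `l = 0`, injectivity
transports the accumulation to the argument of `F`, making `F` constant against its growth. For `l >
0`, the rescaled function `F(hI s) - c` falls under `not_frequently_eq_sq`. -/
theorem finite_setOf_eq_quadratic (hAs : 0 < As) (hβ : 0 < β) {hI : ℝ} (hhI : hI ≠ 0) {F : ℝ → ℝ}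
    (hF : AnalyticOnNhd ℝ F Set.univ) (hgrow : Tendsto F atTop atTop) (hl : 0 ≤ l) (c A : ℝ) :
    {x | |x| ≤ A ∧ F (hI * sspa As β x) = c + l * x ^ 2}.Finite := by
  by_contra hinf
  obtain ⟨x₀, -, hacc⟩ := Set.Infinite.exists_accPt_of_subset_isCompact hinf
    (isCompact_Icc (a := -A) (b := A)) fun x hx => abs_le.1 hx.1
  rw [accPt_iff_frequently_nhdsNE] at hacc
  have hfr : ∃ᶠ x in 𝓝[≠] x₀, F (hI * sspa As β x) = c + l * x ^ 2 := hacc.mono fun x hx => hx.2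
  rcases hl.eq_or_lt with rfl | hl
  · have hu : Tendsto (fun x => hI * sspa As β x) (𝓝[≠] x₀) (𝓝[≠] (hI * sspa As β x₀)) :=
      ((continuous_sspa hAs hβ).const_mul hI).continuousWithinAt.tendsto_nhdsWithin
        fun x hx h => hx (sspa_injective hAs hβ (mul_right_injective₀ hhI h))
    have hfr' : ∃ᶠ s in 𝓝[≠] (hI * sspa As β x₀), F s = (fun _ => c) s :=
      hu.frequently (hfr.mono fun x hx => by simpa using hx)
    have hconst := hF.eq_of_frequently_eq (fun _ _ => analyticAt_const) hfr'
    rw [hconst] at hgrow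
    exact not_tendsto_const_atTop c atTop hgrow
  · have hG : AnalyticOnNhd ℝ (fun s => F (hI * s) - c) Set.univ := fun s _ =>
      ((hF (hI * s) trivial).comp (analyticAt_const.mul analyticAt_id)).sub analyticAt_const
    refine not_frequently_eq_sq hAs hβ hG hl x₀ (hfr.mono fun x hx => ?_)
    rw [hx, add_sub_cancel_left]

end Zeros

/-! ### Finite support of the maximiser. -/

theorem eq_sum_smul_dirac_of_ae_mem {μ : Measure ℝ} {S : Finset ℝ} (h : ∀ᵐ x ∂μ, x ∈ S) :
    μ = ∑ x ∈ S, μ {x} • Measure.dirac x := by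
  classical
  ext s hs
  have e : μ s = μ (S.filter (· ∈ s) : Finset ℝ) := by
    refine measure_congr ?_
    filter_upwards [h] with x hx
    have : x ∈ s ↔ x ∈ (S.filter (· ∈ s) : Finset ℝ) := by simp [hx]
    exact propext this
  rw [e, ← sum_measure_singleton, Finset.sum_filter, Measure.finsetSum_apply]
  refine Finset.sum_congr rfl fun x _ => ?_
  simp [Measure.dirac_apply' _ hs, Set.indicator_apply]

theorem Feasible.ae_eq_zero {A : ℝ} {μ : Measure ℝ} (h : Feasible 0 A μ) : ∀ᵐ x ∂μ, x = 0 := by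
  have h0 : ∫ x, x ^ 2 ∂μ = 0 :=
    le_antisymm (by simpa using h.averagePower) (integral_nonneg fun x => sq_nonneg x)
  rw [integral_eq_zero_iff_of_nonneg (fun x => sq_nonneg x) h.integrable_sq] at h0
  filter_upwards [h0] with x hx
  simpa using hx

/-- Complementary slackness: the slack in the multiplier inequality is nonnegative `μ`-a.e. and its
integral is nonpositive, so equality holds `μ`-a.e., on a set that is finite. -/
theorem exists_ae_mem_finset_of_isMax {As β hI B σ A : ℝ} (hAs : 0 < As) (hβ : 0 < β)
    (hhI : hI ≠ 0) (hA : 0 ≤ A) (hB : ∀ x, |hI * sspa As β x| ≤ B)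
    {μ : Measure ℝ} (hμ : Feasible σ A μ)
    (hmax : ∀ ν : Measure ℝ, Feasible σ A ν →
      crossEntropy (fun x => hI * sspa As β x) ν ν ≤
        crossEntropy (fun x => hI * sspa As β x) μ μ) :
    ∃ S : Finset ℝ, ∀ᵐ x ∂μ, x ∈ S := by
  -- With zero power there is no strictly feasible point for the multiplier argument, but the law is
  -- then concentrated at `0`.
  rcases eq_or_ne σ 0 with rfl | hσ
  · exact ⟨{0}, by simpa using hμ.ae_eq_zero⟩
  have := hμ.isProbabilityMeasure
  set u : ℝ → ℝ := fun x => hI * sspa As β x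
  have hu : Measurable u := (measurable_sspa As β).const_mul hI
  set C := crossEntropy u μ μ
  let f : ℝ → ℝ := fun x => meanSurprisal u μ (u x) - C
  have hfi (ν : Measure ℝ) [IsProbabilityMeasure ν] : ∫ x, f x ∂ν = crossEntropy u μ ν - C := by
    rw [integral_sub (integrable_meanSurprisal hu hB ν) (integrable_const C)]
    simp [crossEntropy]
  obtain ⟨l, hl, hle⟩ := exists_multiplier (σ := σ) hσ hA (f := f) fun ν hν => by
    have := hν.isProbabilityMeasure
    rw [hfi]
    exact sub_nonpos.2 (crossEntropy_le_of_isMax hu hB hμ hmax hν)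
  have hfint : Integrable f μ := (integrable_meanSurprisal hu hB μ).sub (integrable_const C)
  have hqint : Integrable (fun x => l * (x ^ 2 - σ ^ 2)) μ :=
    (hμ.integrable_sq.sub (integrable_const _)).const_mul l
  have hgap : ∀ᵐ x ∂μ, 0 ≤ l * (x ^ 2 - σ ^ 2) - f x := by
    filter_upwards [hμ.peak] with x hx using sub_nonneg.2 (hle x hx)
  have hzero : ∫ x, (l * (x ^ 2 - σ ^ 2) - f x) ∂μ = 0 := by
    refine le_antisymm ?_ (integral_nonneg_of_ae hgap)
    rw [integral_sub hqint hfint, hfi, sub_self, sub_zero, integral_const_mul,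
      integral_sub hμ.integrable_sq (integrable_const _)]
    refine mul_nonpos_of_nonneg_of_nonpos hl ?_
    simpa using hμ.averagePower
  rw [integral_eq_zero_iff_of_nonneg_ae hgap (hqint.sub hfint)] at hzero
  have hgrow : Tendsto (meanSurprisal u μ) atTop atTop := by
    refine tendsto_atTop_mono (le_meanSurprisal hu hB) ?_
    refine tendsto_atTop_add_const_right _ _ (Tendsto.atTop_div_const (by norm_num) ?_)
    exact tendsto_atTop_add_const_right _ _ (tendsto_pow_atTop two_ne_zero)
  have hfin := finite_setOf_eq_quadratic hAs hβ hhI (analyticOnNhd_meanSurprisal hu hB (μ := μ))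
    hgrow hl (C - l * σ ^ 2) A
  refine ⟨hfin.toFinset, ?_⟩
  filter_upwards [hμ.peak, hzero] with x hx hx0
  rw [Set.Finite.mem_toFinset]
  refine ⟨hx, ?_⟩
  have hx0 : l * (x ^ 2 - σ ^ 2) - (meanSurprisal u μ (u x) - C) = 0 := hx0
  show meanSurprisal u μ (u x) = _
  linarith

end AWGN

/-! ### From output entropy back to mutual information. -/

theorem mainTheorem2 (As β hI σ A : ℝ) (hAs : 0 < As) (hβ : 0 < β) (hhI : hI ≠ 0)
    (hA : 0 ≤ A) :
    ∃ μ : MeasureTheory.Measure ℝ,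
      AWGN.IsOptimal As β hI σ A μ ∧
      (∀ ν : MeasureTheory.Measure ℝ, AWGN.IsOptimal As β hI σ A ν → ν = μ) ∧
      ∃ S : Finset ℝ, μ = ∑ x ∈ S, μ {x} • MeasureTheory.Measure.dirac x := by
  have hc : Continuous fun x => hI * AWGN.sspa As β x :=
    (AWGN.continuous_sspa hAs hβ).const_mul hI
  have hinj : Function.Injective fun x => hI * AWGN.sspa As β x :=
    fun x y h => AWGN.sspa_injective hAs hβ (mul_right_injective₀ hhI h)
  have hB (x : ℝ) : |hI * AWGN.sspa As β x| ≤ |hI| * As := by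
    rw [abs_mul]
    exact mul_le_mul_of_nonneg_left (AWGN.abs_sspa_le hAs hβ x) (abs_nonneg _)
  obtain ⟨μ, hμ, hmax⟩ := AWGN.exists_isMaxOn_crossEntropy hc hB (σ := σ) hA
  have := hμ.isProbabilityMeasure
  obtain ⟨S, hS⟩ := AWGN.exists_ae_mem_finset_of_isMax hAs hβ hhI hA hB hμ hmax
  refine ⟨μ, ⟨hμ, fun ν hν => ?_⟩, fun ν hν => ?_, S, AWGN.eq_sum_smul_dirac_of_ae_mem hS⟩
  · have := hν.isProbabilityMeasure
    exact (AWGN.mutualInfo_le_iff hB μ ν).2 (hmax ν hν)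
  · have := hν.1.isProbabilityMeasure
    exact AWGN.eq_of_isMax hc.measurable hinj hB hμ hmax hν.1
      ((AWGN.mutualInfo_le_iff hB ν μ).1 (hν.2 μ hμ))
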